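/- Let $G$ be a finite group of order $n$, let $\pi$ be a set (possibly empty) of prime divisors of $n$, and let $\pi'$ be the set of all primes not in $\pi$. For a set of primes $\sigma$, a $\sigma$-number is a positive integer all of whose prime divisors lie in $\sigma$. Every element $x$ of a finite group $K$ can be written uniquely as $x = x_\sigma x_{\sigma'}$, where $x_\sigma, x_{\sigma'} \in K$ commute, the order $o(x_\sigma)$ is a $\sigma$-number and $o(x_{\sigma'})$ is a $\sigma'$-number, $\sigma'$ being the set of primes not in $\sigma$. Put $$\psi_\sigma(K) = \sum_{x \in K} o(x_\sigma).$$ Let $C_n$ be the cyclic group of order $n$. If $\psi_\pi(G) = \psi_\pi(C_n)$ and $\psi_{\pi'}(G) = \psi_{\pi'}(C_n)$, then $G \cong C_n$. -/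

import Mathlib

/-- A `π`-number: a positive integer all of whose prime divisors lie in `π`. -/
def IsPiNumber (π : Set ℕ) (m : ℕ) : Prop :=
  m ≠ 0 ∧ ∀ p : ℕ, p.Prime → p ∣ m → p ∈ π

/-- The set `π'` of all primes that are not in `π`. -/
def piCompl (π : Set ℕ) : Set ℕ := {p | p.Prime ∧ p ∉ π}

theorem IsPiNumber.mul {π : Set ℕ} {a b : ℕ} (ha : IsPiNumber π a) (hb : IsPiNumber π b) :
    IsPiNumber π (a * b) :=
  ⟨mul_ne_zero ha.1 hb.1, fun p hp h => (hp.dvd_mul.1 h).elim (ha.2 p hp) (hb.2 p hp)⟩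

theorem IsPiNumber.of_dvd {π : Set ℕ} {a b : ℕ} (hb : IsPiNumber π b) (h : a ∣ b) :
    IsPiNumber π a :=
  ⟨fun h0 => hb.1 (by simpa [h0] using h), fun p hp hpa => hb.2 p hp (hpa.trans h)⟩

theorem IsPiNumber.coprime {π : Set ℕ} {a b : ℕ} (ha : IsPiNumber π a)
    (hb : IsPiNumber (piCompl π) b) : Nat.Coprime a b :=
  Nat.coprime_of_dvd fun p hp hpa hpb => (hb.2 p hp hpb).2 (ha.2 p hp hpa)

theorem exists_piNumber_mul (π : Set ℕ) (k : ℕ) (hk : k ≠ 0) :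
    ∃ a b : ℕ, a * b = k ∧ IsPiNumber π a ∧ IsPiNumber (piCompl π) b := by
  have h1 : ∀ σ : Set ℕ, IsPiNumber σ 1 := fun σ =>
    ⟨one_ne_zero, fun p hp h => absurd (Nat.dvd_one.1 h) hp.ne_one⟩
  have hprime : ∀ (σ : Set ℕ) (p : ℕ), p.Prime → p ∈ σ → IsPiNumber σ p := fun σ p hp hpσ =>
    ⟨hp.ne_zero, fun q hq h => by rwa [(Nat.prime_dvd_prime_iff_eq hq hp).1 h]⟩
  induction k using induction_on_primes with
  | zero => exact absurd rfl hk
  | one => exact ⟨1, 1, rfl, h1 _, h1 _⟩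
  | prime_mul p k hp ih =>
    obtain ⟨a, b, hab, ha, hb⟩ := ih (right_ne_zero_of_mul hk)
    by_cases hpπ : p ∈ π
    · exact ⟨p * a, b, by rw [mul_assoc, hab], (hprime _ p hp hpπ).mul ha, hb⟩
    · exact ⟨a, p * b, by rw [mul_left_comm, hab], ha, (hprime (piCompl π) p hp ⟨hp, hpπ⟩).mul hb⟩

/-- `y` and `z` are the `π`-part and the `π'`-part of `x`: they commute, `x = y z`, the order of
`y` is a `π`-number and the order of `z` is a `π'`-number. -/
def IsPiDecomposition {G : Type*} [Group G] (π : Set ℕ) (x y z : G) : Prop :=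
  x = y * z ∧ Commute y z ∧ IsPiNumber π (orderOf y) ∧ IsPiNumber (piCompl π) (orderOf z)

theorem exists_isPiDecomposition {G : Type*} [Group G] [Finite G] (π : Set ℕ) (x : G) :
    ∃ y z : G, IsPiDecomposition π x y z := by
  obtain ⟨a, b, hab, ha, hb⟩ := exists_piNumber_mul π (orderOf x) (orderOf_pos x).ne'
  obtain ⟨u, hu0, hu1⟩ := Nat.chineseRemainder (ha.coprime hb) 1 0
  obtain ⟨v, hv0, hv1⟩ := Nat.chineseRemainder (ha.coprime hb) 0 1
  refine ⟨x ^ u, x ^ v, ?_, (Commute.refl x).pow_pow u v, ha.of_dvd ?_, hb.of_dvd ?_⟩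
  · rw [← pow_add]
    have h : u + v ≡ 1 [MOD orderOf x] := by
      rw [← hab, ← Nat.modEq_and_modEq_iff_modEq_mul (ha.coprime hb)]
      exact ⟨hu0.add hv0, hu1.add hv1⟩
    simpa using (pow_eq_pow_iff_modEq.2 h).symm
  · apply orderOf_dvd_of_pow_eq_one
    rw [← pow_mul, ← orderOf_dvd_iff_pow_eq_one, ← hab, mul_comm a b]
    exact mul_dvd_mul_right ((Nat.modEq_zero_iff_dvd).1 hu1) a
  · apply orderOf_dvd_of_pow_eq_one
    rw [← pow_mul, ← orderOf_dvd_iff_pow_eq_one, ← hab]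
    exact mul_dvd_mul_right ((Nat.modEq_zero_iff_dvd).1 hv0) b

theorem IsPiDecomposition.unique {G : Type*} [Group G] {π : Set ℕ} {x y z y' z' : G}
    (h : IsPiDecomposition π x y z) (h' : IsPiDecomposition π x y' z') : y = y' ∧ z = z' := by
  obtain ⟨hx, hc, hy, hz⟩ := h
  obtain ⟨hx', hc', hy', hz'⟩ := h'
  obtain ⟨t, ht1, ht0⟩ := Nat.chineseRemainder ((hy.mul hy').coprime (hz.mul hz')) 1 0
  have key : ∀ {v w : G}, x = v * w → Commute v w → orderOf v ∣ orderOf y * orderOf y' →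
      orderOf w ∣ orderOf z * orderOf z' → x ^ t = v := by
    intro v w hvw hcomm hv hw
    have e1 : v ^ t = v := by simpa using pow_eq_pow_iff_modEq.2 (ht1.of_dvd hv)
    have e2 : w ^ t = 1 := by simpa using pow_eq_pow_iff_modEq.2 (ht0.of_dvd hw)
    rw [hvw, hcomm.mul_pow, e1, e2, mul_one]
  have e : y = y' := (key hx hc (dvd_mul_right _ _) (dvd_mul_right _ _)).symm.trans
    (key hx' hc' (dvd_mul_left _ _) (dvd_mul_left _ _))
  refine ⟨e, ?_⟩
  subst e
  exact mul_left_cancel (hx.symm.trans hx')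

/-- The `π`-part `x_π` of an element `x` of a finite group. -/
noncomputable def piPart {G : Type*} [Group G] [Finite G] (π : Set ℕ) (x : G) : G :=
  (exists_isPiDecomposition π x).choose

/-- `x = x_π z` for some `z` commuting with `x_π`, of `π'`-order; by uniqueness of the
decomposition this characterizes `x_π`. -/
theorem piPart_spec {G : Type*} [Group G] [Finite G] (π : Set ℕ) (x : G) :
    ∃ z : G, IsPiDecomposition π x (piPart π x) z :=
  (exists_isPiDecomposition π x).choose_spec

/-- `ψ_π(G) = ∑_{x ∈ G} o(x_π)`. -/
noncomputable def psi (π : Set ℕ) (G : Type*) [Group G] [Fintype G] : ℕ :=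
  ∑ x : G, orderOf (piPart π x)

/-! Among groups of order `n`, the cyclic group maximizes the sum of the `σ`-parts of the element
orders, for every finite `σ` (`sum_primePart_orderOf_le`). The proof adds one prime `p` at a time.
If no element has order divisible by the full `p`-part of `n`, a crude estimate is already strict.
Otherwise the Sylow `p`-subgroups are cyclic, and the elements are grouped by their `p`-part `y`. If
`y ≠ 1`, the cofactors lie in the normal `p`-complement of the centralizer of `y`
(`exists_complement_centralizer`), to which induction applies. Counting the conjugates of `y` in a
Sylow subgroup `P` (`sum_mul_card_conj_mem`) then gives the bound.

In the equality case a generator of `P` shows that `P` is central in its normalizer. The two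
hypotheses give equality for `π` and for `π'`, hence this conclusion for every prime divisor of `n`.
By Burnside's transfer theorem the group is then abelian with cyclic Sylow subgroups, so it is
cyclic. -/

open Finset

/-! ### Prime parts and mean orders -/

/-- The largest divisor of `m` whose prime factors all lie in `σ`. -/
def primePart (σ : Finset ℕ) (m : ℕ) : ℕ := ∏ p ∈ σ, p ^ m.factorization p

/-- The mean order of an element of the cyclic group of order `p ^ a`, for a prime `p`. -/
def meanOrder (p a : ℕ) : ℚ := (∑ i ∈ range (a + 1), (p ^ i).totient * (p : ℚ) ^ i) / (p : ℚ) ^ a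

/-- The mean of `primePart σ` over the orders of the elements of a cyclic group of order `n`. -/
def meanPrimePart (σ : Finset ℕ) (n : ℕ) : ℚ := ∏ p ∈ σ, meanOrder p (n.factorization p)

theorem primePart_insert {p : ℕ} {τ : Finset ℕ} (h : p ∉ τ) (m : ℕ) :
    primePart (insert p τ) m = p ^ m.factorization p * primePart τ m :=
  prod_insert h

theorem meanPrimePart_insert {p : ℕ} {τ : Finset ℕ} (h : p ∉ τ) (n : ℕ) :
    meanPrimePart (insert p τ) n = meanOrder p (n.factorization p) * meanPrimePart τ n :=
  prod_insert h

theorem primePart_mul (σ : Finset ℕ) {a b : ℕ} (ha : a ≠ 0) (hb : b ≠ 0) :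
    primePart σ (a * b) = primePart σ a * primePart σ b := by
  simp [primePart, Nat.factorization_mul ha hb, pow_add, prod_mul_distrib]

theorem primePart_eq_one {σ : Finset ℕ} {m : ℕ} (h : ∀ p ∈ σ, p.Prime → ¬ p ∣ m) :
    primePart σ m = 1 := by
  refine prod_eq_one fun p hp => ?_
  by_cases hpp : p.Prime
  · rw [Nat.factorization_eq_zero_of_not_dvd (h p hp hpp), pow_zero]
  · rw [Nat.factorization_eq_zero_of_not_prime _ hpp, pow_zero]

theorem primePart_eq_self {σ : Finset ℕ} {m : ℕ} (hm : m ≠ 0) (h : m.primeFactors ⊆ σ) :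
    primePart σ m = m := by
  rw [primePart, ← prod_subset h]
  · exact Nat.prod_factorization_pow_eq_self hm
  · intro p _ hp
    rw [← Nat.support_factorization, Finsupp.notMem_support_iff] at hp
    rw [hp, pow_zero]

theorem meanOrder_zero (p : ℕ) : meanOrder p 0 = 1 := by simp [meanOrder]

theorem meanOrder_pos {p : ℕ} (hp : p.Prime) (a : ℕ) : 0 < meanOrder p a := by
  have hp0 : (0 : ℚ) < p := by exact_mod_cast hp.pos
  refine div_pos (sum_pos (fun i _ => mul_pos ?_ (pow_pos hp0 i)) ⟨0, by simp⟩) (pow_pos hp0 a)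
  exact_mod_cast Nat.totient_pos.2 (pow_pos hp.pos i)

theorem meanOrder_le_pow {p : ℕ} (hp : p.Prime) (a : ℕ) : meanOrder p a ≤ (p : ℚ) ^ a := by
  have hp1 : (1 : ℚ) ≤ p := by exact_mod_cast hp.one_le
  have hpa : (0 : ℚ) < (p : ℚ) ^ a := pow_pos (by linarith) a
  have hs : ∑ i ∈ range (a + 1), ((p ^ i).totient : ℚ) = (p : ℚ) ^ a := by
    have := Nat.sum_totient (p ^ a)
    rw [Nat.divisors_prime_pow hp, sum_map] at this
    exact_mod_cast this
  rw [meanOrder, div_le_iff₀ hpa]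
  calc ∑ i ∈ range (a + 1), ((p ^ i).totient : ℚ) * (p : ℚ) ^ i
      ≤ ∑ i ∈ range (a + 1), ((p ^ i).totient : ℚ) * (p : ℚ) ^ a := by
        refine sum_le_sum fun i hi => mul_le_mul_of_nonneg_left ?_ (Nat.cast_nonneg _)
        exact pow_le_pow_right₀ hp1 (Nat.lt_succ_iff.1 (mem_range.1 hi))
    _ = (p : ℚ) ^ a * (p : ℚ) ^ a := by rw [← sum_mul, hs]

/-- The non-generators form the subgroup of index `p`; the generators, a proportion `1 - 1/p`, have
order `p ^ (a + 1)`. -/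
theorem meanOrder_succ {p : ℕ} (hp : p.Prime) (a : ℕ) :
    meanOrder p (a + 1) = meanOrder p a / p + (p ^ a * (p - 1) : ℚ) := by
  have hp0 : (p : ℚ) ≠ 0 := by exact_mod_cast hp.ne_zero
  rw [meanOrder, sum_range_succ, meanOrder, Nat.totient_prime_pow_succ hp, Nat.cast_mul,
    Nat.cast_sub hp.one_le]
  push_cast
  field_simp
  ring

theorem meanOrder_le_succ {p : ℕ} (hp : p.Prime) (a : ℕ) :
    meanOrder p a ≤ meanOrder p (a + 1) := by
  have hp2 : (2 : ℚ) ≤ p := by exact_mod_cast hp.two_le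
  have hp0 : (0 : ℚ) < p := by linarith
  have h := meanOrder_le_pow hp a
  have hm := meanOrder_pos hp a
  have e : meanOrder p a / p + meanOrder p a * (1 - 1 / p) = meanOrder p a := by ring
  have h1 : (1 - 1 / p : ℚ) ≤ p - 1 := by
    have : (1 / p : ℚ) > 0 := by positivity
    linarith
  rw [meanOrder_succ hp]
  have : meanOrder p a * (1 - 1 / p : ℚ) ≤ (p : ℚ) ^ a * (p - 1) :=
    (mul_le_mul_of_nonneg_left h1 hm.le).trans (mul_le_mul_of_nonneg_right h (by linarith))
  linarith

theorem meanOrder_mono {p : ℕ} (hp : p.Prime) : Monotone (meanOrder p) :=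
  monotone_nat_of_le_succ (meanOrder_le_succ hp)

/-- The generators alone contribute `p ^ a * (p - 1)`, and the rest is positive. This settles the
case where no element has maximal `p`-part. -/
theorem pow_lt_meanOrder_succ {p : ℕ} (hp : p.Prime) (a : ℕ) :
    (p : ℚ) ^ a < meanOrder p (a + 1) := by
  have hp2 : (2 : ℚ) ≤ p := by exact_mod_cast hp.two_le
  have hp0 : (0 : ℚ) < p := by linarith
  have h : 0 < meanOrder p a / p := div_pos (meanOrder_pos hp a) hp0
  rw [meanOrder_succ hp]
  nlinarith [pow_pos hp0 a]

theorem meanPrimePart_pos (σ : Finset ℕ) (n : ℕ) : 0 < meanPrimePart σ n := by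
  refine prod_pos fun p _ => ?_
  by_cases hp : p.Prime
  · exact meanOrder_pos hp _
  · rw [Nat.factorization_eq_zero_of_not_prime _ hp, meanOrder_zero]
    exact one_pos

theorem meanPrimePart_le_of_dvd (σ : Finset ℕ) {k n : ℕ} (hn : n ≠ 0) (h : k ∣ n) :
    meanPrimePart σ k ≤ meanPrimePart σ n := by
  have hk : k ≠ 0 := ne_zero_of_dvd_ne_zero hn h
  have key : ∀ p, 0 ≤ meanOrder p (k.factorization p) ∧
      meanOrder p (k.factorization p) ≤ meanOrder p (n.factorization p) := by
    intro p
    by_cases hp : p.Prime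
    · exact ⟨(meanOrder_pos hp _).le,
        meanOrder_mono hp ((Nat.factorization_le_iff_dvd hk hn).2 h p)⟩
    · simp [Nat.factorization_eq_zero_of_not_prime _ hp, meanOrder_zero]
  exact prod_le_prod (fun p _ => (key p).1) fun p _ => (key p).2

/-! ### Sums over cyclic groups -/

theorem sum_orderOf_of_isCyclic {P : Type*} [Group P] [Fintype P] [IsCyclic P] {p a : ℕ}
    (hp : p.Prime) (hP : Fintype.card P = p ^ a) :
    ∑ u : P, (orderOf u : ℚ) = (p : ℚ) ^ a * meanOrder p a := by
  classical
  have hp0 : (p : ℚ) ≠ 0 := by exact_mod_cast hp.ne_zero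
  have h1 : ∑ u : P, (orderOf u : ℚ) = ∑ d ∈ (p ^ a).divisors, (d.totient : ℚ) * d := by
    rw [← sum_fiberwise_of_maps_to (t := (p ^ a).divisors) (g := fun u : P => orderOf u)]
    · refine sum_congr rfl fun d hd => ?_
      rw [sum_congr rfl (g := fun _ => (d : ℚ)) (fun u hu => by rw [(mem_filter.1 hu).2]),
        sum_const, nsmul_eq_mul,
        IsCyclic.card_orderOf_eq_totient (hP ▸ Nat.dvd_of_mem_divisors hd)]
    · intro u _
      exact Nat.mem_divisors.2 ⟨hP ▸ orderOf_dvd_card, (pow_pos hp.pos a).ne'⟩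
  rw [h1, Nat.divisors_prime_pow hp, sum_map, meanOrder, mul_div_cancel₀ _ (pow_ne_zero a hp0)]
  simp

-- The left side is a Dirichlet convolution with `ζ`, hence multiplicative in `n`, so prime powers
-- suffice.
open ArithmeticFunction ArithmeticFunction.zeta in
theorem sum_totient_mul_primePart (σ : Finset ℕ) {n : ℕ} (hn : n ≠ 0) :
    ∑ d ∈ n.divisors, (d.totient : ℚ) * primePart σ d = n * meanPrimePart σ n := by
  let f : ArithmeticFunction ℚ := ⟨fun d => (d.totient : ℚ) * primePart σ d, by simp⟩
  have hf : f.IsMultiplicative := by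
    refine IsMultiplicative.iff_ne_zero.2 ⟨by simp [f, primePart], ?_⟩
    intro a b ha hb hab
    simp only [f, ArithmeticFunction.coe_mk, Nat.totient_mul hab, primePart_mul σ ha hb]
    push_cast
    ring
  have hg : (f * (ζ : ArithmeticFunction ℚ)).IsMultiplicative :=
    hf.mul isMultiplicative_zeta.natCast
  have e : ∀ m, (f * (ζ : ArithmeticFunction ℚ)) m = ∑ d ∈ m.divisors, f d := fun m =>
    coe_mul_zeta_apply
  have key : ∀ p ∈ n.primeFactors, (f * (ζ : ArithmeticFunction ℚ)) (p ^ n.factorization p) =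
      (p : ℚ) ^ n.factorization p *
        if p ∈ σ then meanOrder p (n.factorization p) else 1 := by
    intro p hp
    have hpp := Nat.prime_of_mem_primeFactors hp
    have hp0 : (p : ℚ) ≠ 0 := by exact_mod_cast hpp.ne_zero
    have hpart : ∀ i, primePart σ (p ^ i) = if p ∈ σ then p ^ i else 1 := by
      intro i
      split_ifs with h
      · refine primePart_eq_self (pow_pos hpp.pos i).ne' fun q hq => ?_
        have hqp := Nat.prime_of_mem_primeFactors hq
        rwa [(Nat.prime_dvd_prime_iff_eq hqp hpp).1
          (hqp.dvd_of_dvd_pow (Nat.dvd_of_mem_primeFactors hq))]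
      · refine primePart_eq_one fun q hq hqp hqd => h ?_
        rwa [← (Nat.prime_dvd_prime_iff_eq hqp hpp).1 (hqp.dvd_of_dvd_pow hqd)]
    rw [e, Nat.divisors_prime_pow hpp, sum_map]
    simp only [f, ArithmeticFunction.coe_mk, Function.Embedding.coeFn_mk, hpart]
    split_ifs with h
    · rw [meanOrder, mul_div_cancel₀ _ (pow_ne_zero _ hp0)]
      simp
    · have := Nat.sum_totient (p ^ n.factorization p)
      rw [Nat.divisors_prime_pow hpp, sum_map] at this
      simp only [Nat.cast_one, mul_one]
      exact_mod_cast this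
  have h1 := e n
  rw [hg.multiplicative_factorization _ hn, Finsupp.prod, Nat.support_factorization,
    prod_congr rfl key, prod_mul_distrib] at h1
  have h2 : ∏ p ∈ n.primeFactors, (p : ℚ) ^ n.factorization p = n := by
    exact_mod_cast Nat.prod_factorization_pow_eq_self hn
  have h3 : (∏ p ∈ n.primeFactors, if p ∈ σ then meanOrder p (n.factorization p) else 1) =
      meanPrimePart σ n := by
    rw [← prod_filter, filter_mem_eq_inter, inter_comm, meanPrimePart, ← filter_mem_eq_inter,
      prod_filter]
    refine prod_congr rfl fun p _ => ?_
    split_ifs with h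
    · rfl
    · rw [← Nat.support_factorization, Finsupp.notMem_support_iff] at h
      rw [h, meanOrder_zero]
  rw [h2, h3] at h1
  exact h1.symm

theorem sum_primePart_orderOf_of_isCyclic (σ : Finset ℕ) {C : Type*} [Group C] [Fintype C]
    [IsCyclic C] :
    ∑ x : C, (primePart σ (orderOf x) : ℚ) =
      Fintype.card C * meanPrimePart σ (Fintype.card C) := by
  classical
  rw [← sum_totient_mul_primePart σ Fintype.card_ne_zero,
    ← sum_fiberwise_of_maps_to (t := (Fintype.card C).divisors) (g := fun u : C => orderOf u)]
  · refine sum_congr rfl fun d hd => ?_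
    rw [sum_congr rfl (g := fun _ => (primePart σ d : ℚ))
        (fun u hu => by rw [(mem_filter.1 hu).2]), sum_const, nsmul_eq_mul,
      IsCyclic.card_orderOf_eq_totient (Nat.dvd_of_mem_divisors hd)]
  · intro u _
    exact Nat.mem_divisors.2 ⟨orderOf_dvd_card, Fintype.card_ne_zero⟩

/-! ### Transfer and normal complements -/

/-- A cyclic Sylow `p`-subgroup containing a nontrivial central element is central in its
normalizer. -/
theorem Sylow.normalizer_le_centralizer_of_mem_center {H : Type*} [Group H] [Finite H] {p : ℕ}
    [Fact p.Prime] (P : Sylow p H) [IsCyclic P] {y : H} (hy : y ∈ Subgroup.center H)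
    (hyP : y ∈ P) (hy1 : y ≠ 1) :
    Subgroup.normalizer P ≤ Subgroup.centralizer (P : Set H) := by
  refine P.normalizer_le_centralizer_or_le_commutator.resolve_right fun hc => hy1 ?_
  -- Here `P` lies in the commutator subgroup, so the transfer to `P` kills `y`. A central element
  -- transfers to its power with exponent the index of `P`, which is prime to its order.
  let _ : CommGroup P := IsCyclic.commGroup
  let φ : H →* P := MonoidHom.transfer (MonoidHom.id P)
  have h1 : φ y = 1 := Abelianization.commutator_subset_ker φ (hc hyP)
  have key : ∀ (k : ℕ) (g₀ : H), g₀⁻¹ * y ^ k * g₀ ∈ (P : Subgroup H) →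
      g₀⁻¹ * y ^ k * g₀ = y ^ k := by
    intro k g₀ _
    rw [mul_assoc, ← Subgroup.mem_center_iff.1 (pow_mem hy k) g₀, inv_mul_cancel_left]
  have h2 := (MonoidHom.transfer_eq_pow (MonoidHom.id P) y key).symm.trans h1
  have h3 : y ^ (P : Subgroup H).index = 1 := congrArg Subtype.val h2
  have h4 : orderOf y ∣ Nat.card P := by
    rw [← Subgroup.orderOf_mk y hyP]
    exact orderOf_dvd_natCard _
  rw [← orderOf_eq_one_iff]
  exact Nat.eq_one_of_dvd_coprimes P.card_coprime_index h4 (orderOf_dvd_of_pow_eq_one h3)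

/-- The centralizer of a nontrivial element of a cyclic Sylow `p`-subgroup has a normal
`p`-complement. -/
theorem exists_complement_centralizer {G : Type*} [Group G] [Finite G] {p : ℕ} [Fact p.Prime]
    (P : Sylow p G) [IsCyclic P] {y : G} (hyP : y ∈ P) (hy1 : y ≠ 1) :
    ∃ K : Subgroup (Subgroup.centralizer {y}),
      Nat.card K * p ^ (Nat.card G).factorization p = Nat.card (Subgroup.centralizer {y}) ∧
      ∀ z : Subgroup.centralizer {y}, ¬ p ∣ orderOf z → z ∈ K := by
  have hPC : (P : Subgroup G) ≤ Subgroup.centralizer {y} := by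
    intro u hu
    let _ : CommGroup P := IsCyclic.commGroup
    rw [Subgroup.mem_centralizer_singleton_iff]
    exact congrArg Subtype.val (mul_comm (⟨u, hu⟩ : P) ⟨y, hyP⟩)
  let Q : Sylow p (Subgroup.centralizer {y}) := P.subtype hPC
  have e : Q ≃* P := Subgroup.subgroupOfEquivOfLe hPC
  have : IsCyclic Q := isCyclic_of_surjective _ e.symm.surjective
  have hyc : y ∈ Subgroup.centralizer {y} := hPC hyP
  have hN := Q.normalizer_le_centralizer_of_mem_center (y := ⟨y, hyc⟩)
    (Subgroup.mem_center_iff.2 fun g => Subtype.ext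
      ((Subgroup.mem_centralizer_singleton_iff).1 g.2)) hyP
    (fun h => hy1 (congrArg Subtype.val h))
  refine ⟨(MonoidHom.transferSylow Q hN).ker, ?_, fun z hz => ?_⟩
  · rw [← P.card_eq_multiplicity, ← Nat.card_congr e.toEquiv]
    exact (MonoidHom.ker_transferSylow_isComplement' Q hN).card_mul_card
  · rw [MonoidHom.mem_ker, ← orderOf_eq_one_iff]
    have h1 := orderOf_map_dvd (MonoidHom.transferSylow Q hN) z
    obtain ⟨k, hk⟩ := IsPGroup.iff_orderOf.1 Q.isPGroup' (MonoidHom.transferSylow Q hN z)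
    rw [hk] at h1 ⊢
    cases k with
    | zero => rfl
    | succ k => exact absurd ((dvd_pow_self p k.succ_ne_zero).trans h1) hz

/-! ### Orders of `π`-parts -/

theorem orderOf_eq_mul_of_isPiDecomposition {G : Type*} [Group G] {π : Set ℕ} {x y z : G}
    (h : IsPiDecomposition π x y z) : orderOf x = orderOf y * orderOf z := by
  obtain ⟨rfl, hc, hy, hz⟩ := h
  exact hc.orderOf_mul_eq_mul_orderOf_of_coprime (hy.coprime hz)

/-- Only primes dividing the group order matter, so the possibly infinite `π` can be replaced by a
finite `σ`. -/
theorem orderOf_piPart_eq_primePart {G : Type*} [Group G] [Finite G] {π : Set ℕ} {σ : Finset ℕ}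
    (hσ : ∀ p, p.Prime → p ∣ Nat.card G → (p ∈ σ ↔ p ∈ π)) (x : G) :
    orderOf (piPart π x) = primePart σ (orderOf x) := by
  obtain ⟨z, hz⟩ := piPart_spec π x
  rw [orderOf_eq_mul_of_isPiDecomposition hz,
    primePart_mul σ (orderOf_pos _).ne' (orderOf_pos _).ne',
    primePart_eq_self (orderOf_pos _).ne', primePart_eq_one, mul_one]
  · intro p hp hpp hpz
    exact (hz.2.2.2.2 p hpp hpz).2 ((hσ p hpp (hpz.trans (orderOf_dvd_natCard z))).1 hp)
  · intro p hp
    have hpp := Nat.prime_of_mem_primeFactors hp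
    have hpd := Nat.dvd_of_mem_primeFactors hp
    exact (hσ p hpp (hpd.trans (orderOf_dvd_natCard _))).2 (hz.2.2.1.2 p hpp hpd)

theorem orderOf_piPart_singleton {G : Type*} [Group G] [Finite G] {p : ℕ} (x : G) :
    orderOf (piPart {p} x) = p ^ (orderOf x).factorization p := by
  rw [orderOf_piPart_eq_primePart (σ := {p}) (fun q _ _ => by simp) x, primePart, prod_singleton]

theorem isPGroup_zpowers_piPart {G : Type*} [Group G] [Finite G] {p : ℕ} (x : G) :
    IsPGroup p (Subgroup.zpowers (piPart {p} x)) :=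
  IsPGroup.of_card (n := (orderOf x).factorization p)
    (by rw [Nat.card_zpowers, orderOf_piPart_singleton])

/-! ### Counting by `p`-parts and conjugates -/

/-- Bound for the sum of `primePart τ` over all elements with a given nontrivial `p`-part. -/
theorem sum_fiber_piPart_le.{u} {G : Type u} [Group G] [Fintype G] [DecidableEq G] {p : ℕ}
    [hp : Fact p.Prime]
    {τ : Finset ℕ} (hpτ : p ∉ τ)
    (IH : ∀ (H : Type u) [Group H] [Fintype H],
      ∑ x : H, (primePart τ (orderOf x) : ℚ) ≤ Nat.card H * meanPrimePart τ (Nat.card H))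
    (P : Sylow p G) [IsCyclic P] {y : G} (hyP : y ∈ P) (hy1 : y ≠ 1) :
    ∑ x : G with piPart {p} x = y, (primePart τ (orderOf x) : ℚ) ≤
      Nat.card (Subgroup.centralizer {y}) *
        (meanPrimePart τ (Nat.card G) / (p : ℚ) ^ (Nat.card G).factorization p) := by
  classical
  obtain ⟨K, hK, hKz⟩ := exists_complement_centralizer P hyP hy1
  have hinj : Function.Injective fun k : K => y * ((k : Subgroup.centralizer {y}) : G) :=
    fun a b h => Subtype.ext (Subtype.ext (mul_left_cancel h))
  have hp0 : (p : ℚ) ^ (Nat.card G).factorization p ≠ 0 :=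
    pow_ne_zero _ (by exact_mod_cast hp.out.ne_zero)
  have hdvd : Nat.card K ∣ Nat.card G :=
    (Subgroup.card_subgroup_dvd_card K).trans (Subgroup.card_subgroup_dvd_card _)
  calc ∑ x : G with piPart {p} x = y, (primePart τ (orderOf x) : ℚ)
      = ∑ x : G with piPart {p} x = y, (primePart τ (orderOf (y⁻¹ * x)) : ℚ) := by
        refine sum_congr rfl fun x hx => ?_
        obtain ⟨z, hz⟩ := piPart_spec {p} x
        rw [(mem_filter.1 hx).2] at hz
        have hyz : y⁻¹ * x = z := by rw [hz.1, inv_mul_cancel_left]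
        rw [hyz, orderOf_eq_mul_of_isPiDecomposition hz,
          primePart_mul τ (orderOf_pos _).ne' (orderOf_pos _).ne',
          primePart_eq_one (m := orderOf y), one_mul]
        intro q hq hqp hqy
        exact hpτ (hz.2.2.1.2 q hqp hqy ▸ hq)
    -- The cofactor of `y` in `x` centralizes `y` and has order prime to `p`, so it lies in `K`.
    _ ≤ ∑ x ∈ univ.image (fun k : K => y * ((k : Subgroup.centralizer {y}) : G)),
          (primePart τ (orderOf (y⁻¹ * x)) : ℚ) := by
        refine sum_le_sum_of_subset_of_nonneg (fun x hx => ?_) fun _ _ _ => Nat.cast_nonneg _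
        obtain ⟨z, hz⟩ := piPart_spec {p} x
        rw [(mem_filter.1 hx).2] at hz
        have hzc : z ∈ Subgroup.centralizer {y} :=
          Subgroup.mem_centralizer_singleton_iff.2 hz.2.1.symm.eq
        refine mem_image.2 ⟨⟨⟨z, hzc⟩, hKz _ fun h => ?_⟩, mem_univ _, hz.1.symm⟩
        rw [Subgroup.orderOf_mk] at h
        exact (hz.2.2.2.2 p hp.out h).2 rfl
    _ = ∑ k : K, (primePart τ (orderOf k) : ℚ) := by
        rw [sum_image fun a _ b _ h => hinj h]
        simp
    _ ≤ Nat.card K * meanPrimePart τ (Nat.card K) := IH K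
    _ ≤ Nat.card K * meanPrimePart τ (Nat.card G) :=
        mul_le_mul_of_nonneg_left (meanPrimePart_le_of_dvd τ Nat.card_pos.ne' hdvd)
          (Nat.cast_nonneg _)
    _ = _ := by
        rw [← hK]
        push_cast
        field_simp

/-- The number of `g` with `g⁻¹ y g ∈ P` is at least the order of the centralizer of `y`, as soon
as it is not zero. -/
theorem card_centralizer_le_card_conj_mem {G : Type*} [Group G] [Fintype G] (P : Subgroup G)
    [DecidablePred (· ∈ P)] {y g₀ : G} (h : g₀⁻¹ * y * g₀ ∈ P) :
    Nat.card (Subgroup.centralizer {y}) ≤ #{g : G | g⁻¹ * y * g ∈ P} := by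
  classical
  rw [Nat.card_eq_fintype_card, ← card_univ]
  -- The whole coset of the centralizer through `g₀` conjugates `y` to the same element of `P`.
  refine card_le_card_of_injOn (fun c => (c : G) * g₀) (fun c _ => ?_)
    fun a _ b _ hab => Subtype.ext (mul_right_cancel hab)
  have hc := Subgroup.mem_centralizer_singleton_iff.1 c.2
  have : ((c : G) * g₀)⁻¹ * y * (c * g₀) = g₀⁻¹ * y * g₀ := by
    rw [mul_inv_rev, mul_assoc _ y, ← mul_assoc y, ← hc]
    group
  exact mem_filter.2 ⟨mem_univ _, this ▸ h⟩

/-- Double counting of pairs `(y, g)`: for fixed `g`, conjugation by `g` turns the sum over `y` into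
the sum over `P`. -/
theorem sum_mul_card_conj_mem {G : Type*} [Group G] [Fintype G] (P : Subgroup G)
    [DecidablePred (· ∈ P)] (f : G → ℚ) (hf : ∀ g y, f (g * y * g⁻¹) = f y) :
    ∑ y : G, f y * #{g : G | g⁻¹ * y * g ∈ P} = Nat.card G * ∑ u : P, f u := by
  calc ∑ y : G, f y * #{g : G | g⁻¹ * y * g ∈ P}
      = ∑ y : G, ∑ g : G, if g⁻¹ * y * g ∈ P then f y else 0 := by
        refine sum_congr rfl fun y _ => ?_
        rw [← sum_filter, sum_const, nsmul_eq_mul, mul_comm]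
    _ = ∑ g : G, ∑ y : G, if g⁻¹ * y * g ∈ P then f y else 0 := sum_comm
    _ = ∑ g : G, ∑ u : P, f u := by
        refine sum_congr rfl fun g _ => ?_
        have h1 : ∀ y : G, g⁻¹ * (g * y * g⁻¹) * g = y := fun y => by group
        rw [← (MulAut.conj g).toEquiv.sum_comp]
        simp only [MulEquiv.toEquiv_eq_coe, MulEquiv.coe_toEquiv, MulAut.conj_apply, hf, h1]
        rw [← sum_filter]
        exact sum_subtype _ (by simp) f
    _ = _ := by simp [Nat.card_eq_fintype_card]

/-- If an element has `p`-part of the largest possible order, then the Sylow `p`-subgroups are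
cyclic. -/
theorem Sylow.isCyclic_of_factorization_orderOf_eq {G : Type*} [Group G] [Finite G] {p : ℕ}
    [Fact p.Prime] (P : Sylow p G) {x : G}
    (hx : (orderOf x).factorization p = (Nat.card G).factorization p) : IsCyclic P := by
  let Q : Sylow p G := Sylow.ofCard (Subgroup.zpowers (piPart {p} x))
    (by rw [Nat.card_zpowers, orderOf_piPart_singleton, hx])
  have : IsCyclic Q := inferInstanceAs (IsCyclic (Subgroup.zpowers (piPart {p} x)))
  exact isCyclic_of_surjective _ (Q.equiv P).surjective

theorem exists_conj_mem_sylow {G : Type*} [Group G] [Finite G] {p : ℕ} [Fact p.Prime]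
    (P : Sylow p G) {y : G} (hy : IsPGroup p (Subgroup.zpowers y)) : ∃ g : G, g⁻¹ * y * g ∈ P := by
  obtain ⟨Q, hQ⟩ := hy.exists_le_sylow
  obtain ⟨g, rfl⟩ := MulAction.exists_smul_eq G P Q
  refine ⟨g, ?_⟩
  have h : y ∈ (g • P : Sylow p G) := hQ (Subgroup.mem_zpowers y)
  rw [← SetLike.mem_coe, Sylow.coe_smul, Set.mem_smul_set_iff_inv_smul_mem] at h
  simpa [MulAut.smul_def, ← map_inv] using h

/-- Since `u` generates `P`, both have the same centralizer. An element normalizing but not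
centralizing `P` is therefore counted only on the right. -/
theorem card_centralizer_lt_card_conj_mem {G : Type*} [Group G] [Fintype G] (P : Subgroup G)
    [DecidablePred (· ∈ P)] {u : G} (hu : Subgroup.zpowers u = P)
    (h : ¬ Subgroup.normalizer (P : Set G) ≤ Subgroup.centralizer (P : Set G)) :
    Nat.card (Subgroup.centralizer {u}) < #{g : G | g⁻¹ * u * g ∈ P} := by
  classical
  obtain ⟨g, hgN, hgC⟩ := SetLike.not_le_iff_exists.1 h
  have huP : u ∈ P := hu ▸ Subgroup.mem_zpowers u
  have hCP : ∀ c : G, c ∈ Subgroup.centralizer {u} → c ∈ Subgroup.centralizer (P : Set G) := by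
    intro c hc
    rw [← hu, Subgroup.mem_centralizer_iff]
    rintro _ ⟨k, rfl⟩
    exact (Commute.zpow_right (Subgroup.mem_centralizer_singleton_iff.1 hc : Commute c u) k).symm
  have e : Nat.card (Subgroup.centralizer {u}) = #{g : G | g ∈ Subgroup.centralizer {u}} := by
    rw [Nat.card_eq_fintype_card, Fintype.card_subtype]
  rw [e]
  refine card_lt_card ((ssubset_iff_of_subset fun c hc => ?_).2 ⟨g, ?_, ?_⟩)
  · have := Subgroup.mem_centralizer_singleton_iff.1 (mem_filter.1 hc).2
    refine mem_filter.2 ⟨mem_univ _, ?_⟩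
    rwa [mul_assoc, ← this, inv_mul_cancel_left]
  · refine mem_filter.2 ⟨mem_univ _, ?_⟩
    have := (Subgroup.mem_normalizer_iff.1 (inv_mem hgN) u).1 huP
    simpa using this
  · exact fun hg => hgC (hCP g (mem_filter.1 hg).2)

/-- The contribution of nontrivial `p`-parts when the Sylow `p`-subgroups are cyclic. -/
theorem sum_pow_sub_one_mul_primePart_le.{u} {G : Type u} [Group G] [Fintype G] {p : ℕ}
    [hp : Fact p.Prime] {τ : Finset ℕ} (hpτ : p ∉ τ)
    (IH : ∀ (H : Type u) [Group H] [Fintype H],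
      ∑ x : H, (primePart τ (orderOf x) : ℚ) ≤ Nat.card H * meanPrimePart τ (Nat.card H))
    (P : Sylow p G) [IsCyclic P] :
    ∑ x : G, ((p : ℚ) ^ (orderOf x).factorization p - 1) * primePart τ (orderOf x) ≤
        Nat.card G * meanPrimePart τ (Nat.card G) *
          (meanOrder p ((Nat.card G).factorization p) - 1) ∧
      (p ∣ Nat.card G → ¬ Subgroup.normalizer P ≤ Subgroup.centralizer (P : Set G) →
        ∑ x : G, ((p : ℚ) ^ (orderOf x).factorization p - 1) * primePart τ (orderOf x) <
          Nat.card G * meanPrimePart τ (Nat.card G) *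
            (meanOrder p ((Nat.card G).factorization p) - 1)) := by
  classical
  set a := (Nat.card G).factorization p with ha
  set A := meanPrimePart τ (Nat.card G) / (p : ℚ) ^ a with hA
  have hpa : (0 : ℚ) < (p : ℚ) ^ a := pow_pos (by exact_mod_cast hp.out.pos) a
  have hA0 : 0 < A := div_pos (meanPrimePart_pos _ _) hpa
  -- Subtracting `1` removes `y = 1`, whose centralizer need not have a normal `p`-complement.
  let f : G → ℚ := fun y => orderOf y - 1
  have hf0 : ∀ y, 0 ≤ f y := fun y => by
    have : (1 : ℚ) ≤ orderOf y := by exact_mod_cast orderOf_pos y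
    simp only [f]; linarith
  have hfc : ∀ g y, f (g * y * g⁻¹) = f y := fun g y => by
    simp only [f]
    rw [← MulAut.conj_apply, MulEquiv.orderOf_eq]
  have hfib : ∑ x : G, ((p : ℚ) ^ (orderOf x).factorization p - 1) * primePart τ (orderOf x) =
      ∑ y : G, f y * ∑ x : G with piPart {p} x = y, (primePart τ (orderOf x) : ℚ) := by
    rw [← sum_fiberwise (s := univ) (g := fun x : G => piPart {p} x)]
    refine sum_congr rfl fun y _ => ?_
    rw [mul_sum]
    refine sum_congr rfl fun x hx => ?_
    have := orderOf_piPart_singleton (p := p) x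
    rw [(mem_filter.1 hx).2] at this
    simp only [f, this, Nat.cast_pow]
  have hrhs : Nat.card G * meanPrimePart τ (Nat.card G) * (meanOrder p a - 1) =
      ∑ y : G, f y * (#{g : G | g⁻¹ * y * g ∈ (P : Subgroup G)} * A) := by
    have h1 := sum_mul_card_conj_mem (P : Subgroup G) f hfc
    have hcard : Fintype.card P = p ^ a := by
      rw [← Nat.card_eq_fintype_card, P.card_eq_multiplicity]
    have h2 : ∑ u : P, f u = (p : ℚ) ^ a * meanOrder p a - (p : ℚ) ^ a := by
      rw [← sum_orderOf_of_isCyclic hp.out hcard]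
      simp [f, sum_sub_distrib, hcard]
    simp only [← mul_assoc]
    rw [← sum_mul, h1]
    have h3 : ∑ u : (P : Subgroup G), f u = ∑ u : P, f u := rfl
    rw [h3, h2, hA]
    field_simp
  have hle : ∀ y : G, f y * ∑ x : G with piPart {p} x = y, (primePart τ (orderOf x) : ℚ) ≤
      f y * (Nat.card (Subgroup.centralizer {y}) * A) ∧
      f y * ∑ x : G with piPart {p} x = y, (primePart τ (orderOf x) : ℚ) ≤
      f y * (#{g : G | g⁻¹ * y * g ∈ (P : Subgroup G)} * A) := by
    intro y
    by_cases hy1 : y = 1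
    · simp [hy1, f]
    by_cases hfe : ∃ x : G, piPart {p} x = y
    · obtain ⟨x, hx⟩ := hfe
      have hpy : IsPGroup p (Subgroup.zpowers y) := hx ▸ isPGroup_zpowers_piPart x
      obtain ⟨Q, hQ⟩ := hpy.exists_le_sylow
      have : IsCyclic Q := isCyclic_of_surjective _ (P.equiv Q).surjective
      have h1 := sum_fiber_piPart_le hpτ IH Q (hQ (Subgroup.mem_zpowers y)) hy1
      obtain ⟨g, hg⟩ := exists_conj_mem_sylow P hpy
      have h2 : (Nat.card (Subgroup.centralizer {y}) : ℚ) ≤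
          #{g : G | g⁻¹ * y * g ∈ (P : Subgroup G)} := by
        exact_mod_cast card_centralizer_le_card_conj_mem (P : Subgroup G) hg
      exact ⟨mul_le_mul_of_nonneg_left h1 (hf0 y), mul_le_mul_of_nonneg_left
        (h1.trans (mul_le_mul_of_nonneg_right h2 hA0.le)) (hf0 y)⟩
    · rw [filter_eq_empty_iff.2 fun x _ hx => hfe ⟨x, hx⟩, sum_empty, mul_zero]
      constructor <;> exact mul_nonneg (hf0 y) (mul_nonneg (Nat.cast_nonneg _) hA0.le)
  rw [hfib, hrhs]
  refine ⟨sum_le_sum fun y _ => (hle y).2, fun hpG hN => ?_⟩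
  obtain ⟨u, hu⟩ := (Subgroup.isCyclic_iff_exists_zpowers_eq_top (P : Subgroup G)).1 ‹IsCyclic P›
  refine sum_lt_sum (fun y _ => (hle y).2) ⟨u, mem_univ _, (hle u).1.trans_lt ?_⟩
  have hu1 : 0 < f u := by
    have h1 : orderOf u ≠ 1 := fun h => by
      rw [orderOf_eq_one_iff.1 h, Subgroup.zpowers_one_eq_bot] at hu
      exact P.ne_bot_of_dvd_card hpG hu.symm
    have h2 : 1 < orderOf u := lt_of_le_of_ne (orderOf_pos u) (Ne.symm h1)
    have : (1 : ℚ) < orderOf u := by exact_mod_cast h2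
    simp only [f]; linarith
  have h3 : (Nat.card (Subgroup.centralizer {u}) : ℚ) <
      #{g : G | g⁻¹ * u * g ∈ (P : Subgroup G)} := by
    exact_mod_cast card_centralizer_lt_card_conj_mem (P : Subgroup G) hu hN
  exact mul_lt_mul_of_pos_left (mul_lt_mul_of_pos_right h3 hA0) hu1

/-! ### Induction on the set of primes, and equality -/

/-- The bound for `insert p τ` from the bound for `τ`, with the case of equality. -/
theorem sum_primePart_insert_le.{u} {G : Type u} [Group G] [Fintype G] {p : ℕ}
    [hp : Fact p.Prime] {τ : Finset ℕ} (hpτ : p ∉ τ)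
    (IH : ∀ (H : Type u) [Group H] [Fintype H],
      ∑ x : H, (primePart τ (orderOf x) : ℚ) ≤ Nat.card H * meanPrimePart τ (Nat.card H)) :
    ∑ x : G, (primePart (insert p τ) (orderOf x) : ℚ) ≤
        Nat.card G * meanPrimePart (insert p τ) (Nat.card G) ∧
      (p ∣ Nat.card G → ∑ x : G, (primePart (insert p τ) (orderOf x) : ℚ) =
          Nat.card G * meanPrimePart (insert p τ) (Nat.card G) →
        ∀ P : Sylow p G, IsCyclic P ∧
          Subgroup.normalizer P ≤ Subgroup.centralizer (P : Set G)) := by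
  simp only [primePart_insert hpτ, meanPrimePart_insert hpτ, Nat.cast_mul, Nat.cast_pow]
  have hG : (0 : ℚ) < Nat.card G := by exact_mod_cast Nat.card_pos
  have hM := meanPrimePart_pos τ (Nat.card G)
  have hle : ∀ x : G, (orderOf x).factorization p ≤ (Nat.card G).factorization p := fun x =>
    (Nat.factorization_le_iff_dvd (orderOf_pos x).ne' Nat.card_pos.ne').2
      (orderOf_dvd_natCard x) p
  by_cases hx : ∃ x : G, (orderOf x).factorization p = (Nat.card G).factorization p
  · obtain ⟨x, hx⟩ := hx
    have hcyc : ∀ P : Sylow p G, IsCyclic P := fun P =>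
      P.isCyclic_of_factorization_orderOf_eq hx
    -- The first sum is controlled by the nontrivial `p`-parts, the second by `IH` for `G` itself.
    have hsplit : ∑ x : G, (p : ℚ) ^ (orderOf x).factorization p * primePart τ (orderOf x) =
        ∑ x : G, ((p : ℚ) ^ (orderOf x).factorization p - 1) * primePart τ (orderOf x) +
          ∑ x : G, (primePart τ (orderOf x) : ℚ) := by
      rw [← sum_add_distrib]
      exact sum_congr rfl fun x _ => by ring
    have hI := IH G
    rw [hsplit]
    refine ⟨?_, fun hpG heq P => ⟨hcyc P, ?_⟩⟩
    · have := hcyc default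
      have h1 := (sum_pow_sub_one_mul_primePart_le hpτ IH (default : Sylow p G)).1
      linarith
    · have := hcyc P
      by_contra hN
      have h1 := (sum_pow_sub_one_mul_primePart_le hpτ IH P).2 hpG hN
      linarith
  · push Not at hx
    suffices h : ∑ x : G, (p : ℚ) ^ (orderOf x).factorization p * primePart τ (orderOf x) <
        Nat.card G * (meanOrder p ((Nat.card G).factorization p) *
          meanPrimePart τ (Nat.card G)) from ⟨h.le, fun _ he => absurd he h.ne⟩
    obtain ⟨b, hb⟩ : ∃ b, (Nat.card G).factorization p = b + 1 :=
      Nat.exists_eq_succ_of_ne_zero fun h0 => hx 1 (by rw [h0, orderOf_one, Nat.factorization_one]; rfl)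
    have hp1 : (1 : ℚ) ≤ p := by exact_mod_cast hp.out.one_le
    have hI := IH G
    calc ∑ x : G, (p : ℚ) ^ (orderOf x).factorization p * primePart τ (orderOf x)
        ≤ ∑ x : G, (p : ℚ) ^ b * primePart τ (orderOf x) := by
          refine sum_le_sum fun x _ => mul_le_mul_of_nonneg_right
            (pow_le_pow_right₀ hp1 ?_) (Nat.cast_nonneg _)
          have h1 := hle x
          have h2 := hx x
          omega
      _ = (p : ℚ) ^ b * ∑ x : G, (primePart τ (orderOf x) : ℚ) := (mul_sum ..).symm
      _ ≤ (p : ℚ) ^ b * (Nat.card G * meanPrimePart τ (Nat.card G)) :=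
          mul_le_mul_of_nonneg_left hI (by positivity)
      _ < meanOrder p (b + 1) * (Nat.card G * meanPrimePart τ (Nat.card G)) :=
          mul_lt_mul_of_pos_right (pow_lt_meanOrder_succ hp.out b) (mul_pos hG hM)
      _ = _ := by rw [hb]; ring

theorem sum_primePart_orderOf_le.{u} (σ : Finset ℕ) (G : Type u) [Group G] [Fintype G] :
    ∑ x : G, (primePart σ (orderOf x) : ℚ) ≤ Nat.card G * meanPrimePart σ (Nat.card G) := by
  induction σ using Finset.induction_on generalizing G with
  | empty => simp [primePart, meanPrimePart, Nat.card_eq_fintype_card]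
  | insert p τ hpτ ih =>
    by_cases hp : p.Prime
    · have := Fact.mk hp
      exact (sum_primePart_insert_le hpτ fun H _ _ => ih H).1
    · simpa [primePart_insert hpτ, meanPrimePart_insert hpτ,
        Nat.factorization_eq_zero_of_not_prime _ hp, meanOrder_zero] using ih G

/-- Equality in `sum_primePart_orderOf_le` forces the Sylow `p`-subgroups for `p ∈ σ` to be cyclic
and central in their normalizers. -/
theorem sylow_of_sum_primePart_orderOf_eq {G : Type*} [Group G] [Fintype G] {σ : Finset ℕ}
    (h : ∑ x : G, (primePart σ (orderOf x) : ℚ) = Nat.card G * meanPrimePart σ (Nat.card G))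
    {p : ℕ} [Fact p.Prime] (hpσ : p ∈ σ) (hpG : p ∣ Nat.card G) (P : Sylow p G) :
    IsCyclic P ∧ Subgroup.normalizer P ≤ Subgroup.centralizer (P : Set G) := by
  -- Any prime of `σ` may be taken as the last one inserted.
  rw [← insert_erase hpσ] at h
  exact (sum_primePart_insert_le (notMem_erase p σ)
    fun H _ _ => sum_primePart_orderOf_le _ H).2 hpG h P

/-! ### Cyclicity of the group -/

theorem isCyclic_of_sylow_central_in_normalizer {G : Type*} [Group G] [Finite G]
    (h : ∀ p : ℕ, p.Prime → p ∣ Nat.card G → ∀ P : Sylow p G,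
      IsCyclic P ∧ Subgroup.normalizer P ≤ Subgroup.centralizer (P : Set G)) : IsCyclic G := by
  have hZ : IsZGroup G := ⟨fun p hp P => by
    have := Fact.mk hp
    by_cases hpG : p ∣ Nat.card G
    · exact (h p hp hpG P).1
    · have h1 : Nat.card P = 1 := by
        rw [P.card_eq_multiplicity, Nat.factorization_eq_zero_of_not_dvd hpG, pow_zero]
      have := (Nat.card_eq_one_iff_unique.1 h1).1
      infer_instance⟩
  -- The commutator subgroup lies in the kernel of each transfer to a Sylow `p`-subgroup; that
  -- kernel has order prime to `p`, so no prime divides the order of the commutator subgroup.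
  have hc : commutator G = ⊥ := by
    rw [← Subgroup.card_eq_one]
    by_contra hne
    obtain ⟨p, hp, hpc⟩ := Nat.exists_prime_and_dvd hne
    have := Fact.mk hp
    obtain ⟨hcyc, hN⟩ := h p hp (hpc.trans (Subgroup.card_subgroup_dvd_card _)) default
    have := hcyc
    let _ : CommGroup (default : Sylow p G) := IsCyclic.commGroup
    exact MonoidHom.not_dvd_card_ker_transferSylow default hN
      (hpc.trans (Subgroup.card_dvd_of_le (Abelianization.commutator_subset_ker _)))
  let _ : CommGroup G := { ‹Group G› with
    mul_comm := fun a b => by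
      rw [commutator_def, Subgroup.commutator_eq_bot_iff_le_centralizer] at hc
      exact Subgroup.mem_centralizer_iff.1 (hc (Subgroup.mem_top b)) a (Set.mem_univ a) }
  infer_instance

theorem psi_eq_sum_primePart {G : Type*} [Group G] [Fintype G] {π : Set ℕ} {σ : Finset ℕ}
    (hσ : ∀ p, p.Prime → p ∣ Nat.card G → (p ∈ σ ↔ p ∈ π)) :
    (psi π G : ℚ) = ∑ x : G, (primePart σ (orderOf x) : ℚ) := by
  simp only [psi, Nat.cast_sum, orderOf_piPart_eq_primePart hσ]

/-- If `ψ_π` takes the same value on `G` as on the cyclic group of the same order, then the Sylow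
`p`-subgroups of `G` for `p ∈ π` are cyclic and central in their normalizers. -/
theorem sylow_of_psi_eq {G : Type*} [Group G] [Fintype G] {n : ℕ} [NeZero n]
    (hn : Fintype.card G = n) {π : Set ℕ} (h : psi π G = psi π (Multiplicative (ZMod n)))
    {p : ℕ} (hp : p.Prime) (hpπ : p ∈ π) (hpG : p ∣ Nat.card G) (P : Sylow p G) :
    IsCyclic P ∧ Subgroup.normalizer P ≤ Subgroup.centralizer (P : Set G) := by
  classical
  have := Fact.mk hp
  have hG : Nat.card G = n := by rw [Nat.card_eq_fintype_card, hn]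
  have hC : Fintype.card (Multiplicative (ZMod n)) = n := by simp
  let σ : Finset ℕ := n.primeFactors.filter (· ∈ π)
  have hσ : ∀ q, q.Prime → q ∣ n → (q ∈ σ ↔ q ∈ π) := fun q hq hqn => by
    simp [σ, hq, hqn, NeZero.ne n]
  refine sylow_of_sum_primePart_orderOf_eq (σ := σ) ?_ ((hσ p hp (hG ▸ hpG)).2 hpπ) hpG P
  rw [← psi_eq_sum_primePart (π := π) (by rwa [hG]), h,
    psi_eq_sum_primePart (σ := σ) (by rwa [Nat.card_eq_fintype_card, hC]),
    sum_primePart_orderOf_of_isCyclic, hC, hG]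

theorem corollary3p2 {G : Type*} [Group G] [Fintype G] (n : ℕ) [NeZero n]
    (hn : Fintype.card G = n) (π : Set ℕ) (hπ : ∀ p ∈ π, p.Prime ∧ p ∣ n)
    (h : psi π G = psi π (Multiplicative (ZMod n)))
    (h' : psi (piCompl π) G = psi (piCompl π) (Multiplicative (ZMod n))) :
    Nonempty (G ≃* Multiplicative (ZMod n)) := by
  have : IsCyclic G := isCyclic_of_sylow_central_in_normalizer fun p hp hpG P => by
    by_cases hpπ : p ∈ π
    · exact sylow_of_psi_eq hn h hp hpπ hpG P
    · exact sylow_of_psi_eq hn h' hp ⟨hp, hpπ⟩ hpG P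
  exact ⟨mulEquivOfCyclicCardEq (by simp [Nat.card_eq_fintype_card, hn])⟩
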